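/- Let $\mathbb{T}^2=\mathbb{R}^2/\mathbb{Z}^2$, identify $T^*\mathbb{T}^2$ with $\mathbb{T}^2\times\mathbb{R}^2$, and let $V\in C^\infty(\mathbb{T}^2;\mathbb{R})$. Let $\Lambda\subset\mathbb{Z}^2$ be a primitive sublattice of rank $1$, i.e. its real linear span $\langle\Lambda\rangle$ is one-dimensional and $\langle\Lambda\rangle\cap\mathbb{Z}^2=\Lambda$. Let $\mathfrak{e}_\Lambda=(e_1,e_2)$ be a generator of $\Lambda$, and put $\mathfrak{e}_\Lambda^\perp=(-e_2,e_1)$ and $L_\Lambda=\|\mathfrak{e}_\Lambda\|$. Define on $T^*\mathbb{T}^2$ $$H_\Lambda(x,\xi)=\frac{1}{L_\Lambda}\langle\xi,\mathfrak{e}_\Lambda\rangle,\qquad H_\Lambda^\perp(x,\xi)=\frac{1}{L_\Lambda}\langle\xi,\mathfrak{e}_\Lambda^\perp\rangle,\qquad p_\Lambda(x,\xi)=\frac{H_\Lambda(x,\xi)^2}{2}+\mathcal{I}_\Lambda(V)(x),$$ where $$\mathcal{I}_\Lambda(V)(x)=\frac{1}{L_\Lambda}\int_0^{L_\Lambda}V\Big(x+s\,\frac{\mathfrak{e}_\Lambda^\perp}{L_\Lambda}\Big)\,ds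 .$$ For $p=H_\Lambda^\perp$ and $p=p_\Lambda$, let $\varphi_p^t$ ($t\in\mathbb{R}$) denote the Hamiltonian flow of $p$ on $T^*\mathbb{T}^2$, that is, the (complete) flow of $\dot x=\partial_\xi p$, $\dot\xi=-\partial_x p$. Let $$\mathcal{R}(\Lambda)=T^*\mathbb{T}^2\setminus\{(x,\xi):\ H_\Lambda(x,\xi)=0\ \text{ and }\ \partial_x\mathcal{I}_\Lambda(V)(x)=0\},$$ and let $\Pi:T^*\mathbb{T}^2\to\mathbb{T}^2$ be the canonical projection. **Theorem.** Let $\mu$ be a probability measure on $\mathcal{R}(\Lambda)$ that is invariant under $\varphi_{H_\Lambda^\perp}^t$ and $\varphi_{p_\Lambda}^t$ for all $t\in\mathbb{R}$. Then $\Pi_*\mu$ is a probability measure on $\mathbb{T}^2$ that is absolutely continuous with respect to the Lebesgue measure. -/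

import Mathlib

open MeasureTheory
open scoped ContDiff

namespace BiInv

noncomputable section

/-- The torus `ℝ² / ℤ²`. Its measure `volume` is the normalised Lebesgue measure. -/
abbrev T2 : Type := UnitAddTorus (Fin 2)

/-- The Euclidean plane. -/
abbrev E2 : Type := EuclideanSpace ℝ (Fin 2)

/-- The cotangent bundle of the torus, in its standard trivialisation. -/
abbrev CotT2 : Type := T2 × E2

/-- The quotient map from the plane to the torus. -/
def proj (v : E2) : T2 := fun i => ((v i : ℝ) : UnitAddCircle)

/-- Smooth real functions on the torus: those whose periodic lift to the plane is smooth. -/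
def SmoothOnTorus (V : T2 → ℝ) : Prop := ContDiff ℝ ∞ (fun v : E2 => V (proj v))

/-- An integer vector as a vector of the plane. -/
def intVec (k : Fin 2 → ℤ) : E2 := WithLp.toLp 2 (fun i => (k i : ℝ))

/-- The real linear span of a lattice. -/
def realSpan (L : AddSubgroup (Fin 2 → ℤ)) : Submodule ℝ E2 :=
  Submodule.span ℝ (intVec '' (L : Set (Fin 2 → ℤ)))

/-- Primitive sublattices of `ℤ²` of rank one. -/
structure IsPrimitiveRankOne (L : AddSubgroup (Fin 2 → ℤ)) : Prop where
  rank_one : Module.finrank ℝ (realSpan L) = 1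
  primitive : ∀ k : Fin 2 → ℤ, intVec k ∈ realSpan L → k ∈ L

/-- The length of a generator of the lattice. -/
def len (e : Fin 2 → ℤ) : ℝ := ‖intVec e‖

/-- The integer vector obtained from `e` by a rotation of angle `π / 2`. -/
def perp (e : Fin 2 → ℤ) : Fin 2 → ℤ := ![-(e 1), e 0]

/-- The Hamiltonian `H`, the component of the momentum along `e`. -/
def Ham (e : Fin 2 → ℤ) (z : CotT2) : ℝ := (1 / len e) * inner ℝ z.2 (intVec e)

/-- The Hamiltonian `H^⊥`, the component of the momentum orthogonal to `e`. -/
def HamPerp (e : Fin 2 → ℤ) (z : CotT2) : ℝ := (1 / len e) * inner ℝ z.2 (intVec (perp e))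

/-- The average of `V` along the closed geodesics directed by `e^⊥`. -/
def average (e : Fin 2 → ℤ) (V : T2 → ℝ) (x : T2) : ℝ :=
  (1 / len e) * ∫ s in (0 : ℝ)..(len e), V (x + proj ((s / len e) • intVec (perp e)))

/-- The Hamiltonian `p = H² / 2 + I(V)` on the cotangent bundle. -/
def pHam (e : Fin 2 → ℤ) (V : T2 → ℝ) (z : CotT2) : ℝ :=
  Ham e z ^ 2 / 2 + average e V z.1

/-- The gradient of a function on the torus. -/
def torusGrad (f : T2 → ℝ) (x : T2) : E2 := gradient (fun v : E2 => f (x + proj v)) 0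

/-- The Hamiltonian vector field `(∂_ξ p, -∂_x p)` of a function on the cotangent bundle. -/
def hamField (p : CotT2 → ℝ) (z : CotT2) : E2 × E2 :=
  (gradient (fun η : E2 => p (z.1, η)) z.2, -torusGrad (fun y => p (y, z.2)) z.1)

/-- `w = (u, ξ)` describes the integral curve `t ↦ (x₀ + u(t), ξ(t))` of the Hamiltonian vector
field of `p` that starts from `z₀ = (x₀, ξ₀)`. Here `u` is the displacement in the plane. -/
def IsTrajectory (p : CotT2 → ℝ) (z₀ : CotT2) (w : ℝ → E2 × E2) : Prop :=
  w 0 = (0, z₀.2) ∧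
    ∀ t : ℝ, HasDerivAt w (hamField p (z₀.1 + proj (w t).1, (w t).2)) t

/-- Through every point there is exactly one integral curve, and it exists for all times. -/
def FlowIsComplete (p : CotT2 → ℝ) : Prop := ∀ z₀ : CotT2, ∃! w, IsTrajectory p z₀ w

/-- The Hamiltonian flow of `p`. -/
def hamFlow (p : CotT2 → ℝ) (hp : FlowIsComplete p) (t : ℝ) (z : CotT2) : CotT2 :=
  (z.1 + proj ((hp z).choose t).1, ((hp z).choose t).2)

/-! Completeness of the two flows. -/

theorem proj_add (u v : E2) : proj (u + v) = proj u + proj v := by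
  funext i; simp [proj]

theorem proj_surjective (x : T2) : ∃ v : E2, proj v = x := by
  choose f hf using fun i => QuotientAddGroup.mk_surjective (x i)
  exact ⟨WithLp.toLp 2 f, funext hf⟩

theorem proj_intVec (k : Fin 2 → ℤ) : proj (intVec k) = 0 := by
  funext i
  simp only [proj, intVec, Pi.zero_apply]
  exact (AddCircle.coe_eq_zero_iff (1 : ℝ)).2 ⟨k i, by simp⟩

theorem proj_zero : proj 0 = 0 := by
  funext i; simp [proj]

/-- A globally Lipschitz `C¹` vector field has exactly one global integral curve through each
point. -/
theorem existsUnique_integralCurve {E : Type*} [NormedAddCommGroup E] [NormedSpace ℝ E]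
    [CompleteSpace E] (F : E → E) (hF : ContDiff ℝ 1 F) (K : NNReal) (hK : LipschitzWith K F)
    (w₀ : E) : ∃! w : ℝ → E, w 0 = w₀ ∧ ∀ t, HasDerivAt w (F (w t)) t := by
  have hex : ∃ w : ℝ → E, w 0 = w₀ ∧ IsMIntegralCurve (I := modelWithCornersSelf ℝ E) w F := by
    have hε : (0 : ℝ) < 1 / (2 * (K + 1)) := by positivity
    refine exists_isMIntegralCurve_of_isMIntegralCurveOn
      (contMDiff_vectorSpace_iff_contDiff.2 hF) hε (fun x => ?_) w₀
    set ε : ℝ := 1 / (2 * (K + 1)) with hεdef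
    have h0 : (0 : ℝ) ∈ Set.Icc (-ε) ε := ⟨by linarith, hε.le⟩
    set a : NNReal := ‖F x‖₊ / (K + 1) with ha
    have hPL : IsPicardLindelof (fun _ => F) (⟨0, h0⟩ : Set.Icc (-ε) ε) x a 0
        (‖F x‖₊ + K * a) K := by
      refine ⟨fun _ _ => hK.lipschitzOnWith, fun _ _ => continuousOn_const, ?_, ?_⟩
      · intro _ _ y hy
        have h1 := hK.dist_le_mul y x
        have h2 : dist y x ≤ a := hy
        rw [dist_eq_norm] at h1
        have h3 : ‖F y‖ ≤ ‖F x‖ + ‖F y - F x‖ := by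
          have := norm_add_le (F x) (F y - F x); simpa using this
        have h4 : (K : ℝ) * dist y x ≤ K * a := by gcongr
        simp only [NNReal.coe_add, NNReal.coe_mul, coe_nnnorm]
        linarith
      · have hmax : max (ε - 0) (0 - -ε) = ε := by simp
        change ((‖F x‖₊ + K * a : NNReal) : ℝ) * max (ε - 0) (0 - -ε) ≤ (a : ℝ) - ((0 : NNReal) : ℝ)
        rw [hmax, ha, hεdef]
        simp only [NNReal.coe_add, NNReal.coe_mul, NNReal.coe_div, NNReal.coe_one,
          NNReal.coe_zero, coe_nnnorm]
        have hK0 : (0 : ℝ) ≤ K := K.2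
        have hn := norm_nonneg (F x)
        have e1 : (‖F x‖ + K * (‖F x‖ / (K + 1))) * (1 / (2 * ((K : ℝ) + 1)))
            = ‖F x‖ / (K + 1) * ((2 * K + 1) / (2 * ((K : ℝ) + 1))) := by
          field_simp; ring
        rw [e1, sub_zero]
        refine mul_le_of_le_one_right (by positivity) ?_
        rw [div_le_one (by positivity)]
        linarith
    obtain ⟨α, hα0, hα⟩ := hPL.exists_eq_forall_mem_Icc_hasDerivWithinAt₀
    refine ⟨α, hα0, fun t ht => ?_⟩
    have h1 : HasDerivAt α (F (α t)) t :=
      (hα t ⟨ht.1.le, ht.2.le⟩).hasDerivAt (Icc_mem_nhds ht.1 ht.2)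
    exact h1.hasFDerivAt.hasMFDerivAt.hasMFDerivWithinAt
  obtain ⟨w, hw0, hw⟩ := hex
  refine ⟨w, ⟨hw0, fun t => ?_⟩, ?_⟩
  · have h1 : HasFDerivAt w (ContinuousLinearMap.smulRight (1 : ℝ →L[ℝ] ℝ) (F (w t))) t :=
        hasMFDerivAt_iff_hasFDerivAt.1 (hw t)
    simpa using h1.hasDerivAt
  · rintro w' ⟨h0, h1⟩
    refine ODE_solution_unique_univ (v := fun _ => F) (s := fun _ => Set.univ) (t₀ := 0) (K := K)
      (fun _ => hK.lipschitzOnWith) (fun t => ⟨h1 t, trivial⟩) (fun t => ⟨?_, trivial⟩) ?_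
    · have h2 : HasFDerivAt w (ContinuousLinearMap.smulRight (1 : ℝ →L[ℝ] ℝ) (F (w t))) t :=
        hasMFDerivAt_iff_hasFDerivAt.1 (hw t)
      simpa using h2.hasDerivAt
    · rw [h0, hw0]

theorem flowIsComplete_of_lipschitz (p : CotT2 → ℝ)
    (h : ∀ x₀ : T2, ContDiff ℝ 1 (fun w : E2 × E2 => hamField p (x₀ + proj w.1, w.2)) ∧
      ∃ K, LipschitzWith K (fun w : E2 × E2 => hamField p (x₀ + proj w.1, w.2))) :
    FlowIsComplete p := by
  intro z₀
  obtain ⟨h1, K, hK⟩ := h z₀.1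
  exact existsUnique_integralCurve _ h1 K hK (0, z₀.2)

theorem hasGradientAt_inner (c a : E2) (b : ℝ) :
    HasGradientAt (fun η : E2 => b * inner ℝ η c) (b • c) a := by
  rw [hasGradientAt_iff_hasFDerivAt]
  have h := (((innerSL ℝ c).hasFDerivAt (x := a)).const_mul b)
  have e1 : (fun η : E2 => b * inner ℝ η c) = fun η : E2 => b * (innerSL ℝ c) η := by
    funext η; simp [real_inner_comm]
  rw [e1]
  refine h.congr_fderiv ?_
  ext v
  simp

theorem flowIsComplete_HamPerp (e : Fin 2 → ℤ) : FlowIsComplete (HamPerp e) := by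
  refine flowIsComplete_of_lipschitz _ fun x₀ => ?_
  have h : (fun w : E2 × E2 => hamField (HamPerp e) (x₀ + proj w.1, w.2))
      = fun _ => ((1 / len e) • intVec (perp e), (0 : E2)) := by
    funext w
    refine Prod.ext ?_ ?_
    · exact (hasGradientAt_inner (intVec (perp e)) w.2 (1 / len e)).gradient
    · simp only [hamField, torusGrad, HamPerp]
      rw [gradient_fun_const, neg_zero]
  rw [h]
  exact ⟨contDiff_const, 0, LipschitzWith.const _⟩

/-- Periodicity with respect to `ℤ²`. -/
def IsPeriodic {F : Type*} (f : E2 → F) : Prop := ∀ (k : Fin 2 → ℤ) (u : E2), f (u + intVec k) = f u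

theorem IsPeriodic.bounded {F : Type*} [NormedAddCommGroup F] {f : E2 → F} (hp : IsPeriodic f)
    (hf : Continuous f) : ∃ C : NNReal, ∀ u, ‖f u‖₊ ≤ C := by
  obtain ⟨C, hC⟩ := (isCompact_closedBall (0 : E2) 2).exists_bound_of_continuousOn hf.continuousOn
  refine ⟨C.toNNReal, fun u => ?_⟩
  rw [← NNReal.coe_le_coe, coe_nnnorm]
  refine le_trans ?_ (Real.le_coe_toNNReal C)
  have h1 := hp (fun i => -⌊u i⌋) u
  rw [← h1]
  apply hC
  rw [mem_closedBall_zero_iff, EuclideanSpace.norm_eq, Real.sqrt_le_left (by norm_num)]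
  have key : ∀ i, ‖(u + intVec (fun i => -⌊u i⌋)) i‖ ^ 2 ≤ 1 := by
    intro i
    have e1 : (u + intVec (fun i => -⌊u i⌋)) i = Int.fract (u i) := by
      simp [intVec, Int.fract, sub_eq_add_neg]
    rw [e1, Real.norm_eq_abs, sq_abs]
    have h2 := Int.fract_nonneg (u i)
    have h3 := (Int.fract_lt_one (u i)).le
    nlinarith
  rw [Fin.sum_univ_two]
  linarith [key 0, key 1]

theorem IsPeriodic.fderiv {F : Type*} [NormedAddCommGroup F] [NormedSpace ℝ F] {f : E2 → F}
    (hp : IsPeriodic f) : IsPeriodic (fderiv ℝ f) := by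
  intro k u
  rw [← fderiv_comp_add_right]
  congr 1
  exact funext (hp k)

theorem contDiff_integral_periodic (n : ℕ) : ∀ {F : Type} [NormedAddCommGroup F] [NormedSpace ℝ F]
    (f : E2 → F), ContDiff ℝ n f → IsPeriodic f → ∀ (T : ℝ) (c : E2),
    ContDiff ℝ n (fun u : E2 => ∫ s in (0 : ℝ)..T, f (u + (s / T) • c)) := by
  induction n with
  | zero =>
    intro F _ _ f hf _ T c
    have hc : Continuous f := hf.continuous
    refine contDiff_zero.2 ?_
    exact intervalIntegral.continuous_parametric_intervalIntegral_of_continuous' (by fun_prop) 0 T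
  | succ n ih =>
    intro F _ _ f hf hp T c
    have hf' : ContDiff ℝ n (fderiv ℝ f) := hf.fderiv_right (by norm_cast)
    have hd : Differentiable ℝ f := hf.differentiable (by norm_cast)
    have hc : Continuous f := hf.continuous
    have hc' : Continuous (fderiv ℝ f) := hf'.continuous
    push_cast
    refine contDiff_succ_iff_hasFDerivAt.2 ⟨_, ih (fderiv ℝ f) hf' hp.fderiv T c, fun u => ?_⟩
    obtain ⟨C, hC⟩ := hp.fderiv.bounded hc'
    refine intervalIntegral.hasFDerivAt_integral_of_dominated_of_fderiv_le
      (F := fun u s => f (u + (s / T) • c)) (F' := fun u s => fderiv ℝ f (u + (s / T) • c))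
      (bound := fun _ => (C : ℝ)) Filter.univ_mem ?_ ?_ ?_ ?_ ?_ ?_
    · exact Filter.Eventually.of_forall fun v =>
        (Continuous.aestronglyMeasurable (by fun_prop))
    · exact Continuous.intervalIntegrable (by fun_prop) _ _
    · exact Continuous.aestronglyMeasurable (by fun_prop)
    · exact Filter.Eventually.of_forall fun s _ v _ => hC _
    · exact intervalIntegrable_const
    · refine Filter.Eventually.of_forall fun s _ v _ => ?_
      exact (hasFDerivAt_comp_add_right ((s / T) • c)).2 (hd _).hasFDerivAt

theorem average_lift (e : Fin 2 → ℤ) (V : T2 → ℝ) (u : E2) :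
    average e V (proj u) = (1 / len e) * ∫ s in (0 : ℝ)..(len e),
      (fun v : E2 => V (proj v)) (u + (s / len e) • intVec (perp e)) := by
  simp only [average, proj_add]

theorem flowIsComplete_pHam (e : Fin 2 → ℤ) (V : T2 → ℝ) (hV : SmoothOnTorus V) :
    FlowIsComplete (pHam e V) := by
  refine flowIsComplete_of_lipschitz _ fun x₀ => ?_
  obtain ⟨a, rfl⟩ := proj_surjective x₀
  have hper : IsPeriodic (fun v : E2 => V (proj v)) := by
    intro k u; simp only [proj_add, proj_intVec, add_zero]
  set J : E2 → ℝ := fun u => average e V (proj (a + u)) with hJ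
  have hJs : ContDiff ℝ 2 J := by
    have h1 := contDiff_integral_periodic 2 _ (contDiff_infty.1 hV 2) hper (len e)
      (intVec (perp e))
    have h2 : ContDiff ℝ 2 (fun u : E2 => average e V (proj u)) := by
      simp only [average_lift]
      exact contDiff_const.mul (by exact_mod_cast h1)
    exact h2.comp (contDiff_const.add contDiff_id)
  have hJp : IsPeriodic J := by
    intro k u; simp only [hJ, proj_add, proj_intVec, add_zero]
  set D : E2 → E2 →L[ℝ] ℝ := fderiv ℝ J with hD
  have hDs : ContDiff ℝ 1 D := hJs.fderiv_right (by norm_num)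
  obtain ⟨C, hC⟩ := hJp.fderiv.fderiv.bounded
    ((hDs.fderiv_right (m := 0) (by norm_num)).continuous)
  have hDl : LipschitzWith C D := lipschitzWith_of_nnnorm_fderiv_le
    (hDs.differentiable (by norm_num)) hC
  let c : E2 := intVec e
  let A : E2 →L[ℝ] E2 := ((1 / len e) • innerSL ℝ c).smulRight ((1 / len e) • c)
  have hfield : (fun w : E2 × E2 => hamField (pHam e V) (proj a + proj w.1, w.2))
      = fun w => (A w.2, -(InnerProductSpace.toDual ℝ E2).symm (D w.1)) := by
    funext w
    refine Prod.ext ?_ ?_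
    · refine HasGradientAt.gradient ?_
      rw [hasGradientAt_iff_hasFDerivAt]
      have h1 := hasGradientAt_iff_hasFDerivAt.1 (hasGradientAt_inner c w.2 (1 / len e))
      have h2 := ((h1.pow 2).mul_const (1 / 2 : ℝ)).add_const (average e V (proj a + proj w.1))
      have e1 : (fun η : E2 => pHam e V (proj a + proj w.1, η))
          = fun η => (1 / len e * inner ℝ η c) ^ 2 * (1 / 2 : ℝ)
            + average e V (proj a + proj w.1) := by
        funext η; simp only [pHam, Ham, c]; ring
      simp only [e1]
      refine h2.congr_fderiv ?_
      ext v
      simp [A, real_inner_comm]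
      ring
    · change -torusGrad _ _ = _
      congr 1
      simp only [torusGrad, gradient]
      congr 1
      have e1 : (fun v : E2 => pHam e V (proj a + proj w.1 + proj v, w.2))
          = fun v => Ham e (proj a, w.2) ^ 2 / 2 + J (w.1 + v) := by
        funext v; simp only [pHam, Ham, hJ, proj_add, add_assoc]
      simp only [e1]
      rw [fderiv_const_add, fderiv_comp_add_left, add_zero]
  rw [hfield]
  refine ⟨?_, ?_⟩
  · refine ContDiff.prodMk (A.contDiff.comp contDiff_snd) (ContDiff.neg ?_)
    exact (InnerProductSpace.toDual ℝ E2).symm.contDiff.comp (hDs.comp contDiff_fst)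
  · exact ⟨_, (A.lipschitz.comp LipschitzWith.prod_snd).prodMk
      (((InnerProductSpace.toDual ℝ E2).symm.lipschitz.comp
        (hDl.comp LipschitzWith.prod_fst)).neg)⟩

/-! The flows, the critical set and the regular set. -/

/-- The Hamiltonian flow of `H^⊥`. -/
def flowHamPerp (e : Fin 2 → ℤ) : ℝ → CotT2 → CotT2 :=
  hamFlow (HamPerp e) (flowIsComplete_HamPerp e)

/-- The Hamiltonian flow of `p`. -/
def flowP (e : Fin 2 → ℤ) (V : T2 → ℝ) (hV : SmoothOnTorus V) : ℝ → CotT2 → CotT2 :=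
  hamFlow (pHam e V) (flowIsComplete_pHam e V hV)

/-- The critical set: zero momentum along `e` at a critical point of the averaged potential. -/
def critSet (e : Fin 2 → ℤ) (V : T2 → ℝ) : Set CotT2 :=
  {z | Ham e z = 0 ∧ torusGrad (average e V) z.1 = 0}

/-- The regular set, the complement of the critical set. -/
def regularSet (e : Fin 2 → ℤ) (V : T2 → ℝ) : Set CotT2 := (critSet e V)ᶜ

/-- A measure on the regular set, regarded as a measure on the cotangent bundle, is invariant under
all the maps of a flow. -/
def IsFlowInvariant {R : Set CotT2} (μ : Measure R) (φ : ℝ → CotT2 → CotT2) : Prop :=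
  ∀ t : ℝ, MeasurePreserving (φ t) (μ.map Subtype.val) (μ.map Subtype.val)

end

end BiInv

namespace BiInv

open Set Filter Topology

/-! The two flows together spread every regular point over the torus with no singular part. From a
regular point `z`, flow for time `t` with `pHam`, then move along `perp e`: the base point is `z.1 +
y(t) e + s (perp e)`. Here `y' = h`, where `h` is the momentum along `e`, rescaled by `1 / len e`.
If `h` and the force `h'` vanished together, the trajectory would be at an equilibrium, hence
constant, and `z` would be critical. So the zeros of `h` are isolated, `y` is a local diffeomorphism
off a null set of times, and the pairs `(t, s)` that send `z` over a null set `N` form a null set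
(`volume_orbit_null`).

Invariance transfers this to the measure (`measure_null_of_orbit_null`): the part of phase space
over `N` has the same mass as its preimage under every composite of the two flows. By Tonelli that
preimage is null for almost every `(t, s)`. Each composite only has to preserve the measure, so
commutation of the flows plays no role. -/

theorem continuous_proj : Continuous proj :=
  continuous_pi fun _ => (AddCircle.continuous_mk' 1).comp (by fun_prop)

/-! ### The frame `(e, perp e)` and the averaged potential. -/

theorem intVec_ne_zero {e : Fin 2 → ℤ} (he : e ≠ 0) : intVec e ≠ 0 := by
  intro h
  apply he
  funext i
  have h1 : (intVec e) i = (0 : E2) i := by rw [h]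
  simpa [intVec] using h1

theorem len_pos {e : Fin 2 → ℤ} (he : e ≠ 0) : 0 < len e := norm_pos_iff.2 (intVec_ne_zero he)

theorem eq_zero_of_inner_frame_eq_zero {e : Fin 2 → ℤ} (he : e ≠ 0) {g : E2}
    (h1 : inner ℝ g (intVec e) = (0 : ℝ)) (h2 : inner ℝ g (intVec (perp e)) = (0 : ℝ)) :
    g = 0 := by
  simp only [intVec, perp, PiLp.inner_apply, Fin.sum_univ_two, RCLike.inner_apply, conj_trivial,
    Matrix.cons_val_zero, Matrix.cons_val_one, Int.cast_neg] at h1 h2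
  have h3 : (e 0 : ℝ) ^ 2 + (e 1 : ℝ) ^ 2 ≠ 0 := by
    intro h
    apply he
    have a0 : (e 0 : ℝ) = 0 := by nlinarith [sq_nonneg (e 0 : ℝ), sq_nonneg (e 1 : ℝ)]
    have a1 : (e 1 : ℝ) = 0 := by nlinarith [sq_nonneg (e 0 : ℝ), sq_nonneg (e 1 : ℝ)]
    funext i
    fin_cases i
    · exact_mod_cast a0
    · exact_mod_cast a1
  ext i
  fin_cases i
  · refine (mul_eq_zero.1 (?_ : ((e 0 : ℝ) ^ 2 + (e 1 : ℝ) ^ 2) * g 0 = 0)).resolve_left h3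
    linear_combination (e 0 : ℝ) * h1 - (e 1 : ℝ) * h2
  · refine (mul_eq_zero.1 (?_ : ((e 0 : ℝ) ^ 2 + (e 1 : ℝ) ^ 2) * g 1 = 0)).resolve_left h3
    linear_combination (e 1 : ℝ) * h1 + (e 0 : ℝ) * h2

/-- Since `perp e` is an integer vector, the integrand has period `len e`. The shift translates the
integration variable by `r * len e`, which does not change the integral over a period. -/
theorem average_add_perp {e : Fin 2 → ℤ} (he : e ≠ 0) (V : T2 → ℝ) (x : T2) (r : ℝ) :
    average e V (x + proj (r • intVec (perp e))) = average e V x := by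
  have hl := (len_pos he).ne'
  set g : ℝ → ℝ := fun s => V (x + proj ((s / len e) • intVec (perp e))) with hg
  have hper : Function.Periodic g (len e) := fun s => by
    simp only [hg]
    rw [add_div, div_self hl, add_smul, one_smul, proj_add, proj_intVec, add_zero]
  have h1 : ∀ s, V (x + proj (r • intVec (perp e)) + proj ((s / len e) • intVec (perp e)))
      = g (s + r * len e) := fun s => by
    simp only [hg]
    rw [add_div, mul_div_cancel_right₀ _ hl, add_smul, proj_add, add_assoc,
      add_comm (proj (r • _))]
  simp only [average, h1]
  rw [intervalIntegral.integral_comp_add_right, zero_add, add_comm (len e),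
    hper.intervalIntegral_add_eq (r * len e) 0, zero_add]

theorem inner_torusGrad_average_perp {e : Fin 2 → ℤ} (he : e ≠ 0) (V : T2 → ℝ) (x : T2) :
    inner ℝ (torusGrad (average e V) x) (intVec (perp e)) = (0 : ℝ) := by
  set f : E2 → ℝ := fun v => average e V (x + proj v) with hf
  have h1 : inner ℝ (torusGrad (average e V) x) (intVec (perp e))
      = fderiv ℝ f 0 (intVec (perp e)) := by
    simp [torusGrad, gradient, hf]
  rw [h1]
  by_cases hd : DifferentiableAt ℝ f 0
  · have h2 : HasDerivAt (fun r : ℝ => f (r • intVec (perp e)))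
        (fderiv ℝ f 0 (intVec (perp e))) 0 := by
      have h3 : HasFDerivAt f (fderiv ℝ f 0) ((0 : ℝ) • intVec (perp e)) := by
        rw [zero_smul]; exact hd.hasFDerivAt
      have h4 := (hasDerivAt_id (0 : ℝ)).smul_const (intVec (perp e))
      rw [one_smul] at h4
      exact h3.comp_hasDerivAt (0 : ℝ) h4
    have h3 : (fun r : ℝ => f (r • intVec (perp e))) = fun _ => average e V x :=
      funext fun r => average_add_perp he V x r
    rw [h3] at h2
    exact h2.unique (hasDerivAt_const _ _)
  -- No smoothness of `V` is assumed here; at a point of non-differentiability the derivative is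
  -- zero by convention.
  · rw [fderiv_zero_of_not_differentiableAt hd]; rfl

/-! ### The Hamiltonian vector fields and their trajectories. -/

theorem hamField_HamPerp (e : Fin 2 → ℤ) (z : CotT2) :
    hamField (HamPerp e) z = ((1 / len e) • intVec (perp e), 0) := by
  refine Prod.ext ?_ ?_
  · exact (hasGradientAt_inner (intVec (perp e)) z.2 (1 / len e)).gradient
  · simp only [hamField, torusGrad, HamPerp]
    rw [gradient_fun_const, neg_zero]

theorem hamField_pHam (e : Fin 2 → ℤ) (V : T2 → ℝ) (z : CotT2) :
    hamField (pHam e V) z =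
      ((Ham e z * (1 / len e)) • intVec e, -torusGrad (average e V) z.1) := by
  refine Prod.ext ?_ ?_
  · refine HasGradientAt.gradient ?_
    rw [hasGradientAt_iff_hasFDerivAt]
    have h1 := hasGradientAt_iff_hasFDerivAt.1 (hasGradientAt_inner (intVec e) z.2 (1 / len e))
    have h2 := ((h1.pow 2).mul_const (1 / 2 : ℝ)).add_const (average e V z.1)
    have e1 : (fun η : E2 => pHam e V (z.1, η))
        = fun η => (1 / len e * inner ℝ η (intVec e)) ^ 2 * (1 / 2 : ℝ) + average e V z.1 := by
      funext η; simp only [pHam, Ham]; ring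
    simp only [e1]
    refine h2.congr_fderiv ?_
    ext v
    simp [Ham]
    ring
  · change -torusGrad _ _ = _
    congr 1
    simp only [torusGrad, gradient]
    congr 1
    exact fderiv_const_add (f := fun v : E2 => average e V (z.1 + proj v)) (Ham e z ^ 2 / 2)

theorem flowHamPerp_apply (e : Fin 2 → ℤ) (t : ℝ) (z : CotT2) :
    flowHamPerp e t z = (z.1 + proj ((t / len e) • intVec (perp e)), z.2) := by
  have h1 : IsTrajectory (HamPerp e) z fun t => ((t / len e) • intVec (perp e), z.2) := by
    refine ⟨by simp, fun t => ?_⟩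
    rw [hamField_HamPerp]
    refine HasDerivAt.prodMk ?_ (hasDerivAt_const _ _)
    exact ((hasDerivAt_id t).div_const (len e)).smul_const _
  have h2 := (flowIsComplete_HamPerp e z).choose_spec.2 _ h1
  simp only [flowHamPerp, hamFlow, ← h2]

/-- The vector field is autonomous. The displacement already made is subtracted because a trajectory
must start with displacement zero. -/
theorem IsTrajectory.shift {p : CotT2 → ℝ} {z : CotT2} {w : ℝ → E2 × E2}
    (hw : IsTrajectory p z w) (t : ℝ) :
    IsTrajectory p (z.1 + proj (w t).1, (w t).2) fun s => w (s + t) - ((w t).1, 0) := by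
  refine ⟨by ext <;> simp, fun s => ?_⟩
  have h1 := ((hw.2 (s + t)).comp_add_const s t).sub_const ((w t).1, (0 : E2))
  convert! h1 using 2
  refine Prod.ext ?_ ?_
  · change z.1 + proj (w t).1 + proj ((w (s + t)).1 - (w t).1) = z.1 + proj (w (s + t)).1
    rw [add_assoc, ← proj_add, add_sub_cancel]
  · change (w (s + t)).2 - 0 = _
    rw [sub_zero]

/-- A trajectory that meets a zero of the Hamiltonian vector field is at rest. -/
theorem IsTrajectory.eq_of_hamField_eq_zero {p : CotT2 → ℝ} (hp : FlowIsComplete p) {z : CotT2}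
    {w : ℝ → E2 × E2} (hw : IsTrajectory p z w) {t : ℝ}
    (h0 : hamField p (z.1 + proj (w t).1, (w t).2) = 0) : w t = (0, z.2) := by
  have h1 : IsTrajectory p (z.1 + proj (w t).1, (w t).2) fun _ => (0, (w t).2) := by
    refine ⟨rfl, fun s => ?_⟩
    simp only [proj_zero, add_zero, h0]
    exact hasDerivAt_const _ _
  -- The restarted curve is constant by uniqueness; at time `-t` it is back at the initial point.
  have h2 := congrFun ((hp _).unique (hw.shift t) h1) (-t)
  simp only [neg_add_cancel, hw.1] at h2
  have h3 := congrArg Prod.fst h2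
  have h4 := congrArg Prod.snd h2
  simp only [Prod.fst_sub, Prod.snd_sub, zero_sub, sub_zero, neg_eq_zero] at h3 h4
  exact Prod.ext h3 h4.symm

section Trajectory

variable {e : Fin 2 → ℤ} {V : T2 → ℝ} {z : CotT2} {w : ℝ → E2 × E2}

theorem IsTrajectory.hasDerivAt_fst (hw : IsTrajectory (pHam e V) z w) (t : ℝ) :
    HasDerivAt (fun t => (w t).1) ((1 / len e * inner ℝ (w t).2 (intVec e) * (1 / len e)) •
      intVec e) t := by
  have h := (hw.2 t).fst
  rw [hamField_pHam] at h
  exact h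

theorem IsTrajectory.hasDerivAt_snd (hw : IsTrajectory (pHam e V) z w) (t : ℝ) :
    HasDerivAt (fun t => (w t).2) (-torusGrad (average e V) (z.1 + proj (w t).1)) t := by
  have h := (hw.2 t).snd
  rw [hamField_pHam] at h
  exact h

/-- The two factors `1 / len e` make the inner product the coefficient of `e` in the orthogonal
frame. In this coordinate the equation of motion is `y' = h`. -/
theorem IsTrajectory.hasDerivAt_inner_fst (he : e ≠ 0) (hw : IsTrajectory (pHam e V) z w) (t : ℝ) :
    HasDerivAt (fun t => 1 / len e * inner ℝ (w t).1 (intVec e) * (1 / len e))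
      (1 / len e * inner ℝ (w t).2 (intVec e) * (1 / len e)) t := by
  have hl := (len_pos he).ne'
  have h := (((hw.hasDerivAt_fst t).inner ℝ (hasDerivAt_const t (intVec e))).const_mul
    (1 / len e)).mul_const (1 / len e)
  refine h.congr_deriv ?_
  rw [inner_zero_right, zero_add, inner_smul_left, real_inner_self_eq_norm_sq]
  change _ * (_ * len e ^ 2) * _ = _
  simp only [conj_trivial]
  field_simp

/-- The velocity is parallel to `e` and the displacement starts at zero, so no component along `perp
e` ever appears. -/
theorem IsTrajectory.fst_eq_smul (he : e ≠ 0) (hw : IsTrajectory (pHam e V) z w) (t : ℝ) :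
    (w t).1 = (1 / len e * inner ℝ (w t).1 (intVec e) * (1 / len e)) • intVec e := by
  have h : ∀ t, HasDerivAt (fun t => (w t).1 -
      (1 / len e * inner ℝ (w t).1 (intVec e) * (1 / len e)) • intVec e) 0 t := fun t => by
    have := (hw.hasDerivAt_fst t).sub ((hw.hasDerivAt_inner_fst he t).smul_const (intVec e))
    rwa [sub_self] at this
  have h1 := is_const_of_deriv_eq_zero (fun t => (h t).differentiableAt) (fun t => (h t).deriv) t 0
  simp only [hw.1, inner_zero_left, mul_zero, zero_mul, zero_smul, sub_zero] at h1
  exact sub_eq_zero.1 h1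

theorem IsTrajectory.hasDerivAt_inner_snd (hw : IsTrajectory (pHam e V) z w) (t : ℝ) :
    HasDerivAt (fun t => 1 / len e * inner ℝ (w t).2 (intVec e) * (1 / len e))
      (1 / len e * inner ℝ (-torusGrad (average e V) (z.1 + proj (w t).1)) (intVec e) *
        (1 / len e)) t := by
  have h := (((hw.hasDerivAt_snd t).inner ℝ (hasDerivAt_const t (intVec e))).const_mul
    (1 / len e)).mul_const (1 / len e)
  rwa [inner_zero_right, zero_add] at h

/-- Along a regular trajectory the momentum along `e` has simple zeros only. -/
theorem IsTrajectory.force_ne_zero (he : e ≠ 0) (hV : SmoothOnTorus V)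
    (hz : z ∈ regularSet e V) (hw : IsTrajectory (pHam e V) z w) (t : ℝ)
    (h0 : 1 / len e * inner ℝ (w t).2 (intVec e) * (1 / len e) = 0) :
    1 / len e * inner ℝ (-torusGrad (average e V) (z.1 + proj (w t).1)) (intVec e) *
        (1 / len e) ≠ 0 := by
  intro h1
  have hl : 1 / len e ≠ 0 := one_div_ne_zero (len_pos he).ne'
  have h2 := (mul_eq_zero.1 h0).resolve_right hl
  have h3 := (mul_eq_zero.1 ((mul_eq_zero.1 h1).resolve_right hl)).resolve_left hl
  rw [inner_neg_left, neg_eq_zero] at h3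
  -- The gradient is orthogonal to `perp e` in any case, so vanishing force along `e` makes it zero
  -- and the point an equilibrium.
  have h4 := eq_zero_of_inner_frame_eq_zero he h3 (inner_torusGrad_average_perp he V _)
  have h5 := hw.eq_of_hamField_eq_zero (flowIsComplete_pHam e V hV) (t := t) (by
    rw [hamField_pHam]
    simp only [h4, neg_zero, Ham, h2, zero_mul, zero_smul]
    rfl)
  simp only [h5, proj_zero, add_zero] at h2 h4
  exact hz ⟨h2, h4⟩

end Trajectory

/-! ### Pulling null sets of the torus back to the plane of times. -/

/-- Being null is local, and the quotient map preserves measure on the half-open unit square centred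
at any given point. -/
theorem volume_preimage_circle_null {N : Set T2} (hN : MeasurableSet N) (h0 : volume N = 0) :
    volume ((fun (v : Fin 2 → ℝ) (i : Fin 2) => ((v i : ℝ) : UnitAddCircle)) ⁻¹' N) = 0 := by
  refine measure_null_of_locally_null _ fun v _ => ?_
  set B : Set (Fin 2 → ℝ) := univ.pi fun i => Ioc (v i - 1 / 2) (v i - 1 / 2 + 1) with hB
  refine ⟨(fun (v : Fin 2 → ℝ) (i : Fin 2) => ((v i : ℝ) : UnitAddCircle)) ⁻¹' N ∩ B,
    inter_mem self_mem_nhdsWithin (mem_nhdsWithin_of_mem_nhds ?_), ?_⟩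
  · refine set_pi_mem_nhds finite_univ fun i _ => Ioc_mem_nhds ?_ ?_ <;> linarith
  · have h1 := measurePreserving_pi (fun i : Fin 2 =>
        (volume : Measure ℝ).restrict (Ioc (v i - 1 / 2) (v i - 1 / 2 + 1)))
      (fun _ => (volume : Measure UnitAddCircle))
      (fun i => UnitAddCircle.measurePreserving_mk (v i - 1 / 2))
    have h2 := h1.measure_preimage hN.nullMeasurableSet
    rw [← Measure.restrict_pi_pi, Measure.restrict_apply (h1.measurable hN)] at h2
    exact h2.trans h0

/-- The parametrisation of the torus by the frame `(c, perp c)` pulls null sets back to null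
sets. -/
theorem volume_preimage_frame_null {c : Fin 2 → ℤ} (hc : c ≠ 0) {N : Set T2}
    (hN : MeasurableSet N) (h0 : volume N = 0) (x : T2) :
    volume ((fun q : ℝ × ℝ => x + proj (q.1 • intVec c + q.2 • intVec (perp c))) ⁻¹' N) = 0 := by
  have hNx : MeasurableSet ((fun y => x + y) ⁻¹' N) := (measurable_const_add x) hN
  have h1 : volume ((fun y => x + y) ⁻¹' N) = 0 := by
    rw [measure_preimage_add, h0]
  -- The columns are `c` and `perp c`; the determinant is the squared length of `c`.
  let A : Matrix (Fin 2) (Fin 2) ℝ := !![(c 0 : ℝ), -(c 1 : ℝ); (c 1 : ℝ), (c 0 : ℝ)]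
  have hdet : LinearMap.det (Matrix.toLin' A) ≠ 0 := by
    rw [LinearMap.det_toLin', Matrix.det_fin_two_of]
    intro h
    apply hc
    have h0 : (c 0 : ℝ) = 0 := by nlinarith [mul_self_nonneg (c 0 : ℝ), mul_self_nonneg (c 1 : ℝ)]
    have h1 : (c 1 : ℝ) = 0 := by nlinarith [mul_self_nonneg (c 0 : ℝ), mul_self_nonneg (c 1 : ℝ)]
    funext i
    fin_cases i
    · exact_mod_cast h0
    · exact_mod_cast h1
  have h2 := (Measure.LinearMap.quasiMeasurePreserving volume (Matrix.toLin' A) hdet).comp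
    (volume_preserving_finTwoArrow ℝ).symm.quasiMeasurePreserving
  refine Eq.trans ?_ (h2.preimage_null (volume_preimage_circle_null hNx h1))
  congr 1
  ext q
  simp only [mem_preimage, Function.comp]
  rw [iff_iff_eq]
  congr 2
  funext i
  fin_cases i <;>
  simp [proj, intVec, perp, A, Matrix.mulVec, dotProduct, Fin.sum_univ_two, MeasurableEquiv.finTwoArrow,
    mul_comm]

/-- Near a time with `h t ≠ 0` the map `y` is injective, and the change of variables formula equates
the integral of `|h|` over the local preimage with the measure of its image, which is zero. -/
theorem volume_preimage_null_of_hasDerivAt_ne_zero {y h : ℝ → ℝ} (hy : ∀ t, HasDerivAt y (h t) t)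
    (hh : Continuous h) {B : Set ℝ} (hB : volume B = 0) :
    volume {t | h t ≠ 0 ∧ y t ∈ B} = 0 := by
  refine measure_null_of_locally_null _ fun t ht => ?_
  have hs : HasStrictDerivAt y (h t) t :=
    hasStrictDerivAt_of_hasDerivAt_of_continuousAt (Eventually.of_forall hy) hh.continuousAt
  have hy' : Continuous y := continuous_iff_continuousAt.2 fun t => (hy t).continuousAt
  have hinv := (hs.hasStrictFDerivAt_equiv ht.1).eventually_left_inverse
  obtain ⟨U, hU, hUo, htU⟩ := eventually_nhds_iff.1 hinv
  -- The measurable hull replaces `B`, which need not be measurable.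
  set s : Set ℝ := U ∩ ({t | h t ≠ 0} ∩ y ⁻¹' (toMeasurable volume B)) with hsdef
  have hsm : MeasurableSet s := hUo.measurableSet.inter
    ((isOpen_ne_fun hh continuous_const).measurableSet.inter
      (hy'.measurable (measurableSet_toMeasurable _ _)))
  refine ⟨s, ?_, ?_⟩
  · filter_upwards [self_mem_nhdsWithin, mem_nhdsWithin_of_mem_nhds (hUo.mem_nhds htU)] with r h1 h2
    exact ⟨h2, h1.1, subset_toMeasurable _ _ h1.2⟩
  · have hinj : InjOn y s := fun a ha b hb hab => by
      rw [← hU a ha.1, ← hU b hb.1, hab]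
    have h1 := lintegral_image_eq_lintegral_abs_deriv_mul hsm
      (fun r _ => (hy r).hasDerivWithinAt) hinj (fun _ => 1)
    have h2 : volume (y '' s) = 0 := by
      refine measure_mono_null ?_ ((measure_toMeasurable B).trans hB)
      rintro _ ⟨r, hr, rfl⟩
      exact hr.2.2
    simp only [lintegral_one, Measure.restrict_apply_univ, h2, mul_one] at h1
    have h3 := (lintegral_eq_zero_iff (by fun_prop)).1 h1.symm
    have h4 : ∀ᵐ r ∂(volume.restrict s), False := by
      filter_upwards [h3, ae_restrict_mem hsm] with r h5 h6
      have : 0 < |h r| := abs_pos.2 h6.2.1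
      simp at h5
      exact h6.2.1 h5
    rw [eventually_false_iff_eq_bot, ae_eq_bot, Measure.restrict_eq_zero] at h4
    exact h4

/-- Simple zeros are isolated, so near each one the zero set is a single point. -/
theorem volume_zeros_null_of_hasDerivAt_ne_zero {h h' : ℝ → ℝ}
    (hh : ∀ t, HasDerivAt h (h' t) t) (hz : ∀ t, h t = 0 → h' t ≠ 0) :
    volume {t | h t = 0} = 0 := by
  refine measure_null_of_locally_null _ fun t ht => ⟨{t}, ?_, by simp⟩
  have h1 : ∀ᶠ r in 𝓝[≠] t, h r ≠ 0 := (hh t).eventually_ne (hz t ht)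
  rw [eventually_nhdsWithin_iff] at h1
  filter_upwards [self_mem_nhdsWithin, mem_nhdsWithin_of_mem_nhds h1] with r h2 h3
  by_contra h4
  exact h3 h4 h2

/-- A curve with almost everywhere non-vanishing velocity in one direction, spread along the other
direction of a frame, meets a null set of the torus for almost no parameters. -/
theorem volume_spread_null {c : Fin 2 → ℤ} (hc : c ≠ 0) {N : Set T2}
    (hN : MeasurableSet N) (h0 : volume N = 0) (x : T2) {y h : ℝ → ℝ}
    (hy : ∀ t, HasDerivAt y (h t) t) (hh : Continuous h) (hz : volume {t | h t = 0} = 0) :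
    volume {q : ℝ × ℝ | x + proj (y q.1 • intVec c + q.2 • intVec (perp c)) ∈ N} = 0 := by
  have hy' : Continuous y := continuous_iff_continuousAt.2 fun t => (hy t).continuousAt
  set ψ : ℝ × ℝ → T2 := fun q => x + proj (q.1 • intVec c + q.2 • intVec (perp c)) with hψ
  have hψm : Measurable ψ := by
    have : Continuous ψ := continuous_const.add (continuous_proj.comp (by fun_prop))
    exact this.measurable
  have h1 := volume_preimage_frame_null hc hN h0 x
  have hm : Measurable fun q : ℝ × ℝ => (y q.1, q.2) := by fun_prop
  -- Fubini: the first coordinates whose slice is not null form a null set, to be pulled back by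
  -- `y`.
  have hb := Measure.measure_ae_null_of_prod_null (μ := volume) (ν := volume) h1
  have hset : MeasurableSet ((ψ ∘ fun q : ℝ × ℝ => (y q.1, q.2)) ⁻¹' N) := (hψm.comp hm) hN
  refine (Measure.measure_prod_null hset).2 ?_
  have h2 := volume_preimage_null_of_hasDerivAt_ne_zero hy hh hb
  refine measure_mono_null ?_ (measure_union_null hz h2)
  intro t ht
  by_cases h3 : h t = 0
  · exact Or.inl h3
  · exact Or.inr ⟨h3, ht⟩

/-! ### Joint orbits and invariant measures. -/

theorem generator_ne_zero {e : Fin 2 → ℤ}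
    (h : IsPrimitiveRankOne (AddSubgroup.zmultiples e)) : e ≠ 0 := by
  rintro rfl
  have h1 := h.rank_one
  have h0 : intVec 0 = 0 := by ext i; simp [intVec]
  have h2 : realSpan (AddSubgroup.zmultiples (0 : Fin 2 → ℤ)) = ⊥ := by
    rw [realSpan, AddSubgroup.zmultiples_zero_eq_bot, AddSubgroup.coe_bot, image_singleton, h0,
      Submodule.span_zero_singleton]
  rw [h2, finrank_bot] at h1
  exact zero_ne_one h1

theorem isTrajectory_choose {p : CotT2 → ℝ} (hp : FlowIsComplete p) (z : CotT2) :
    IsTrajectory p z (hp z).choose := (hp z).choose_spec.1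

theorem continuous_hamFlow {p : CotT2 → ℝ} (hp : FlowIsComplete p) (z : CotT2) :
    Continuous fun t => hamFlow p hp t z := by
  have h : Continuous (hp z).choose :=
    continuous_iff_continuousAt.2 fun t => ((isTrajectory_choose hp z).2 t).continuousAt
  exact (continuous_const.add (continuous_proj.comp (continuous_fst.comp h))).prodMk
    (continuous_snd.comp h)

/-- The joint orbit of a regular point under the two flows meets the fibres over a null set for
almost no pair of times. -/
theorem volume_orbit_null {e : Fin 2 → ℤ} (he : e ≠ 0) {V : T2 → ℝ} (hV : SmoothOnTorus V)
    {N : Set T2} (hN : MeasurableSet N) (h0 : volume N = 0) {z : CotT2}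
    (hz : z ∈ regularSet e V) :
    volume {q : ℝ × ℝ | (flowHamPerp e (q.2 * len e) (flowP e V hV q.1 z)).1 ∈ N} = 0 := by
  have hw := isTrajectory_choose (flowIsComplete_pHam e V hV) z
  set w := (flowIsComplete_pHam e V hV z).choose with hwdef
  have hh : Continuous fun t => 1 / len e * inner ℝ (w t).2 (intVec e) * (1 / len e) :=
    continuous_iff_continuousAt.2 fun t => (hw.hasDerivAt_inner_snd t).continuousAt
  have h1 := volume_spread_null he hN h0 z.1 (hw.hasDerivAt_inner_fst he) hh
    (volume_zeros_null_of_hasDerivAt_ne_zero hw.hasDerivAt_inner_snd (hw.force_ne_zero he hV hz))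
  convert! h1 using 4 with q
  -- The flow of `HamPerp` has unit speed, so time `q.2 * len e` is a shift by `q.2 • intVec (perp
  -- e)`.
  rw [flowHamPerp_apply, mul_div_cancel_right₀ _ (len_pos he).ne', proj_add,
    ← hw.fst_eq_smul he q.1, ← add_assoc]
  rfl

/-- If the orbits of a family of measure preserving maps meet a set for almost no parameters, then
the set is null. -/
theorem measure_null_of_orbit_null {Ω : Type*} [MeasurableSpace Ω] {ν : Measure Ω} [SFinite ν]
    {φ : ℝ × ℝ → Ω → Ω} (hφ : ∀ q, MeasurePreserving (φ q) ν ν)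
    (hm : Measurable fun a : Ω × (ℝ × ℝ) => φ a.2 a.1) {A : Set Ω} (hA : MeasurableSet A)
    (h : ∀ᵐ z ∂ν, volume {q | φ q z ∈ A} = 0) : ν A = 0 := by
  have h1 : (ν.prod (volume : Measure (ℝ × ℝ))) ((fun a : Ω × (ℝ × ℝ) => φ a.2 a.1) ⁻¹' A) = 0 :=
    (Measure.measure_prod_null (hm hA)).2 h
  have h2 : ((volume : Measure (ℝ × ℝ)).prod ν)
      ((fun a : (ℝ × ℝ) × Ω => φ a.1 a.2) ⁻¹' A) = 0 := by
    have hs : MeasurableSet ((fun a : (ℝ × ℝ) × Ω => φ a.1 a.2) ⁻¹' A) :=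
      (hm.comp measurable_swap) hA
    rw [← Measure.prod_swap, Measure.map_apply measurable_swap hs]
    exact h1
  -- Almost every `q` makes the preimage of `A` null; since Lebesgue measure is nonzero, such a `q`
  -- exists, and one suffices.
  obtain ⟨q, hq⟩ := (Measure.measure_ae_null_of_prod_null h2).exists
  exact ((hφ q).measure_preimage hA.nullMeasurableSet).symm.trans hq

end BiInv

theorem theoremA2 (V : BiInv.T2 → ℝ) (hV : BiInv.SmoothOnTorus V)
    (L : AddSubgroup (Fin 2 → ℤ)) (hL : BiInv.IsPrimitiveRankOne L)
    (e : Fin 2 → ℤ) (he : AddSubgroup.zmultiples e = L)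
    (μ : MeasureTheory.Measure (BiInv.regularSet e V)) [MeasureTheory.IsProbabilityMeasure μ]
    (hperp : BiInv.IsFlowInvariant μ (BiInv.flowHamPerp e))
    (hp : BiInv.IsFlowInvariant μ (BiInv.flowP e V hV)) :
    MeasureTheory.IsProbabilityMeasure
        (μ.map (fun z : BiInv.regularSet e V => (z : BiInv.CotT2).1)) ∧
      (μ.map (fun z : BiInv.regularSet e V => (z : BiInv.CotT2).1)).AbsolutelyContinuous
        (MeasureTheory.volume : MeasureTheory.Measure BiInv.T2) := by
  subst he
  have he := BiInv.generator_ne_zero hL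
  have hfst : Measurable fun z : BiInv.regularSet e V => (z : BiInv.CotT2).1 :=
    measurable_fst.comp measurable_subtype_coe
  refine ⟨Measure.isProbabilityMeasure_map hfst.aemeasurable,
    Measure.AbsolutelyContinuous.mk fun N hN h0 => ?_⟩
  set ν : Measure BiInv.CotT2 := μ.map Subtype.val with hν
  have hA : MeasurableSet (Prod.fst ⁻¹' N : Set BiInv.CotT2) := measurable_fst hN
  -- Joint measurability follows from continuity in time and measurability in the point at each
  -- fixed time. The latter is part of the invariance hypothesis, so continuous dependence on
  -- initial data is not required.
  have hflow : Measurable fun a : BiInv.CotT2 × (ℝ × ℝ) => BiInv.flowP e V hV a.2.1 a.1 :=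
    (measurable_uncurry_of_continuous_of_measurable (u := BiInv.flowP e V hV)
      (BiInv.continuous_hamFlow _) fun t => (hp t).measurable).comp
      ((measurable_fst.comp measurable_snd).prodMk measurable_fst)
  have hm : Measurable fun a : BiInv.CotT2 × (ℝ × ℝ) =>
      BiInv.flowHamPerp e (a.2.2 * BiInv.len e) (BiInv.flowP e V hV a.2.1 a.1) := by
    simp only [BiInv.flowHamPerp_apply]
    have hc : Continuous fun s : ℝ =>
        BiInv.proj ((s * BiInv.len e / BiInv.len e) • BiInv.intVec (BiInv.perp e)) :=
      BiInv.continuous_proj.comp (by fun_prop)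
    exact ((measurable_fst.comp hflow).add
      (hc.measurable.comp (measurable_snd.comp measurable_snd))).prodMk (measurable_snd.comp hflow)
  have hnull : ν (Prod.fst ⁻¹' N) = 0 := by
    refine BiInv.measure_null_of_orbit_null
      (φ := fun q z => BiInv.flowHamPerp e (q.2 * BiInv.len e) (BiInv.flowP e V hV q.1 z))
      (fun q => (hperp _).comp (hp q.1)) hm hA ?_
    refine (ae_map_iff measurable_subtype_coe.aemeasurable
      (measurable_measure_prodMk_left (hm hA) (measurableSet_singleton 0))).2 ?_
    exact Filter.Eventually.of_forall fun z => BiInv.volume_orbit_null he hV hN h0 z.2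
  rw [Measure.map_apply hfst hN]
  rwa [hν, Measure.map_apply measurable_subtype_coe hA] at hnull
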